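/- All graphs are finite and simple. A predominated graph is a pair $(G,D)$ with $D\subseteq V(G)$. In the Maker-Breaker domination game on $(G,D)$, Staller and Dominator alternately claim unclaimed vertices of $G$ (vertices of $D$ may also be claimed), Staller moving first. Staller wins if she claims all vertices of the closed neighborhood $N_G[v]$ of some $v\in V(G)\setminus D$; Dominator wins if the vertices he claims dominate every vertex of $V(G)\setminus D$. To say that a player wins on $(G,D)$ means that this player has a winning strategy. The pair $(G,D)$ is *MBD critical* if Staller wins on $(G,D)$, but Dominator wins on $(G,D\cup\{v\})$ for every $v\in V(G)\setminus D$. It is *atomic MBD critical* if, moreover, $D$ is an independent set and no vertex of $D$ is isolated in $G$. For a tree $T$, let $S(T)$ be the tree obtained from $T$ by subdividing each edge exactly once, and let $X(S(T))=V(T)$ be the set of its non-subdivision vertices. Let $\mathcal S=\{S(T): T \text{ is a tree}\}$ (up to isomorphism), each $F\in\mathcal S$ being taken with its set $X(F)$. A graph $F\in\mathcal S$ is a *substructure* in a graph $G$ if $F$ is a subgraph of $G$ and $\deg_G(v)=\deg_F(v)$ for every $v\in X(F)$. **Theorem.** Let $T$ be a tree and $D\subseteq V(T)$. (i) $(T,D)$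 is MBD critical if and only if there exists a substructure $F\in\mathcal S$ in $T$ such that $D=V(T)\setminus X(F)$. (ii) $(T,D)$ is atomic MBD critical if and only if $T\in\mathcal S$ and $D=V(T)\setminus X(T)$. -/

import Mathlib

universe u

namespace MBD

/-- The two players of the Maker-Breaker domination game. -/
inductive Player
  | staller
  | dominator

/-- A position of the game: the sets of vertices claimed so far by the two players. -/
structure Position (V : Type u) where
  staller : Set V
  dominator : Set V

namespace Position

variable {V : Type u}

/-- The vertex `v` has not been claimed by either player. -/
def Unclaimed (p : Position V) (v : V) : Prop :=
  v ∉ p.staller ∧ v ∉ p.dominator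

/-- The position after the given player claims `v`. -/
def claim (p : Position V) : Player → V → Position V
  | .staller, v => ⟨insert v p.staller, p.dominator⟩
  | .dominator, v => ⟨p.staller, insert v p.dominator⟩

/-- The position before the first move. -/
def start : Position V := ⟨∅, ∅⟩

end Position

variable {V : Type u}

/-- The closed neighborhood `N[v]`. -/
def closedNeighborSet (G : SimpleGraph V) (v : V) : Set V :=
  insert v (G.neighborSet v)

/-- The goal of each player on `(G, D)`. Staller: she has claimed the whole closed neighborhood
of some vertex outside `D`. Dominator: the vertices he has claimed dominate every vertex
outside `D`. -/
def Achieved (G : SimpleGraph V) (D : Set V) : Player → Position V → Prop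
  | .staller, p => ∃ v ∉ D, closedNeighborSet G v ⊆ p.staller
  | .dominator, p => ∀ v ∉ D, ∃ w ∈ closedNeighborSet G v, w ∈ p.dominator

/-- `CanForce G D P t p`: in the game on `(G, D)`, at position `p` with player `t` to move,
player `P` can force the achievement of their goal, whatever the opponent does. The players
alternately claim unclaimed vertices; the play is over when no vertex is unclaimed. (A goal that
has been achieved remains achieved under any further moves.) -/
inductive CanForce (G : SimpleGraph V) (D : Set V) (P : Player) :
    Player → Position V → Prop
  | achieved {t : Player} {p : Position V} :
      Achieved G D P p → CanForce G D P t p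
  | ownMove {t t' : Player} {p : Position V} (v : V) :
      t = P → t' ≠ P → p.Unclaimed v →
      CanForce G D P t' (p.claim t v) → CanForce G D P t p
  | opponentMove {t : Player} {p : Position V} :
      t ≠ P → (∃ v, p.Unclaimed v) →
      (∀ v, p.Unclaimed v → CanForce G D P P (p.claim t v)) → CanForce G D P t p

/-- Staller has a winning strategy in the (Staller-start) game on `(G, D)`. -/
def StallerWins (G : SimpleGraph V) (D : Set V) : Prop :=
  CanForce G D .staller .staller Position.start

/-- Dominator has a winning strategy in the (Staller-start) game on `(G, D)`. -/
def DominatorWins (G : SimpleGraph V) (D : Set V) : Prop :=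
  CanForce G D .dominator .staller Position.start

/-- `(G, D)` is MBD critical. -/
def IsCritical (G : SimpleGraph V) (D : Set V) : Prop :=
  StallerWins G D ∧ ∀ v ∉ D, DominatorWins G (D ∪ {v})

/-- `(G, D)` is atomic MBD critical. -/
def IsAtomicCritical (G : SimpleGraph V) (D : Set V) : Prop :=
  IsCritical G D ∧ G.IsIndepSet D ∧ ∀ v ∈ D, ¬ G.IsIsolated v

/-- The graph obtained from `T` by subdividing each edge exactly once: its vertices are the
vertices and the edges of `T`, and its edges are the incident vertex-edge pairs of `T`. -/
def subdivision {W : Type u} (T : SimpleGraph W) : SimpleGraph (W ⊕ T.edgeSet) where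
  Adj
    | .inl w, .inr e => w ∈ (e : Sym2 W)
    | .inr e, .inl w => w ∈ (e : Sym2 W)
    | _, _ => False
  symm := ⟨by
    rintro (a | a) (b | b) h
    · exact h
    · exact h
    · exact h
    · exact h⟩
  loopless := ⟨by
    rintro (a | a) h
    · exact h
    · exact h⟩

/-- `MemS F X`: up to isomorphism, `F` is the subdivision `S(T)` of a finite tree `T`, and
`X = X(F)` is the set of those vertices of `F` that correspond to the vertices of `T`. -/
def MemS {U : Type u} (F : SimpleGraph U) (X : Set U) : Prop :=
  ∃ (W : Type u) (_ : Finite W) (T : SimpleGraph W), T.IsTree ∧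
    ∃ φ : subdivision T ≃g F, X = Set.range (fun w : W => φ (Sum.inl w))

/-- The subgraph `F` of `G`, with its set `X` of fixed-degree vertices, is a substructure in `G`:
`F ∈ 𝒮` with `X = X(F)`, and `deg_G(v) = deg_F(v)` for all `v ∈ X`. -/
def IsSubstructure (G : SimpleGraph V) (F : G.Subgraph) (X : Set F.verts) : Prop :=
  MemS F.coe X ∧
    ∀ v ∈ X, (G.neighborSet (v : V)).ncard = (F.neighborSet (v : V)).ncard

end MBD

namespace MBD

universe v

variable {V : Type v} {G : SimpleGraph V} {D : Set V}

/-! Everything reduces to Hall's condition for the open neighborhoods of the vertices in `Y = Dᶜ`.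
If they have distinct representatives, the bipartition of the tree turns these into a matching
covering `Y` (`exists_matching_of_injOn`), and Dominator wins by pairing. Otherwise take a minimal
violator `X`. Minimality and bipartiteness give that `X` is independent, that `|N(X)| = |X| - 1`,
and that each vertex of `N(X)` has at least two neighbors in `X`. A tree has fewer than `|X| +
|N(X)|` edges between the two sets, so there are exactly two: `N(X)` subdivides the edges of a tree
on `X`, which is a substructure (`HallViolator.exists_isSubstructure`).

Conversely, on a substructure Staller wins by repeated threats (`canForce_staller_of_card_lt`),
while predominating one vertex of `X(F)` destroys all Hall violators, by connectedness. In a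
critical pair no vertex outside the violator can be left out of `D`, so `D` is exactly its
complement. For (ii), the atomic conditions force the substructure to be the whole tree. -/

/-! ### At most one player has a winning strategy. -/

theorem not_canForce_dominator_of_achieved_staller {t : Player} {p : Position V}
    (h : CanForce G D .dominator t p) (hp : Disjoint p.staller p.dominator)
    (ha : Achieved G D .staller p) : False := by
  obtain ⟨x, hx, hxs⟩ := ha
  induction h with
  | achieved h =>
    obtain ⟨w, hw, hwd⟩ := h x hx
    exact Set.disjoint_left.1 hp (hxs hw) hwd
  | ownMove u ht _ hu _ ih =>
    subst ht
    exact ih (Set.disjoint_insert_right.2 ⟨hu.1, hp⟩) hxs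
  | @opponentMove t p ht hex _ ih =>
    obtain ⟨u, hu⟩ := hex
    cases t with
    | dominator => exact ht rfl
    | staller =>
      exact ih u hu (Set.disjoint_insert_left.2 ⟨hu.2, hp⟩) (hxs.trans (Set.subset_insert _ _))

theorem not_canForce_staller_of_achieved_dominator {t : Player} {p : Position V}
    (h : CanForce G D .staller t p) (hp : Disjoint p.staller p.dominator)
    (ha : Achieved G D .dominator p) : False := by
  induction h with
  | achieved h =>
    exact not_canForce_dominator_of_achieved_staller (t := .staller) (.achieved ha) hp h
  | ownMove u ht _ hu _ ih =>
    subst ht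
    exact ih (Set.disjoint_insert_left.2 ⟨hu.2, hp⟩) ha
  | @opponentMove t p ht hex _ ih =>
    obtain ⟨u, hu⟩ := hex
    cases t with
    | staller => exact ht rfl
    | dominator =>
      refine ih u hu (Set.disjoint_insert_right.2 ⟨hu.1, hp⟩) fun x hx => ?_
      obtain ⟨w, hw, hwd⟩ := ha x hx
      exact ⟨w, hw, Set.mem_insert_of_mem _ hwd⟩

/-- The two strategies are played against each other. Claimed sets stay disjoint and goals, once
achieved, persist, so both goals cannot be reached. -/
theorem not_canForce_both {t : Player} {p : Position V}
    (hs : CanForce G D .staller t p) (hd : CanForce G D .dominator t p)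
    (hp : Disjoint p.staller p.dominator) : False := by
  induction hs with
  | achieved h => exact not_canForce_dominator_of_achieved_staller hd hp h
  | @ownMove t t' p u ht ht' hu hc ih =>
    subst ht
    cases hd with
    | achieved h =>
      exact not_canForce_staller_of_achieved_dominator (.ownMove u rfl ht' hu hc) hp h
    | ownMove w hw => cases hw
    | opponentMove _ _ h =>
      cases t' with
      | staller => exact ht' rfl
      | dominator => exact ih (h u hu) (Set.disjoint_insert_left.2 ⟨hu.2, hp⟩)
  | @opponentMove t p ht hex hc ih =>
    cases t with
    | staller => exact ht rfl
    | dominator =>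
      cases hd with
      | achieved h =>
        exact not_canForce_staller_of_achieved_dominator (.opponentMove ht hex hc) hp h
      | @ownMove _ t' _ u _ ht' hu h =>
        cases t' with
        | dominator => exact absurd rfl ht'
        | staller => exact ih u hu h (Set.disjoint_insert_right.2 ⟨hu.1, hp⟩)
      | opponentMove h => exact h rfl

theorem StallerWins.not_dominatorWins (hs : StallerWins G D) : ¬ DominatorWins G D := fun hd =>
  not_canForce_both hs hd (by simp [Position.start])

/-! ### Explicit strategies for the two players. -/

theorem CanForce.mono_predominated {D' : Set V} {t : Player} {p : Position V}
    (h : CanForce G D .staller t p) (hD : D' ⊆ D) : CanForce G D' .staller t p := by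
  induction h with
  | achieved h =>
    obtain ⟨x, hx, hxs⟩ := h
    exact .achieved ⟨x, fun h => hx (hD h), hxs⟩
  | ownMove u ht ht' hu _ ih => exact .ownMove u ht ht' hu ih
  | opponentMove ht hex _ ih => exact .opponentMove ht hex ih

theorem unclaimed_claim_iff {p : Position V} {t : Player} {u v : V} :
    (p.claim t u).Unclaimed v ↔ v ≠ u ∧ p.Unclaimed v := by
  cases t <;> simp [Position.claim, Position.Unclaimed] <;> tauto

theorem ncard_unclaimed_claim_lt [Finite V] {p : Position V} {u : V} (hu : p.Unclaimed u)
    (t : Player) : {v | (p.claim t u).Unclaimed v}.ncard < {v | p.Unclaimed v}.ncard := by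
  refine Set.ncard_lt_ncard ⟨fun v hv => (unclaimed_claim_iff.1 hv).2, fun h => ?_⟩
  exact (unclaimed_claim_iff.1 (h hu)).1 rfl

/-- Dominator's pairing strategy: `M` is a matching of `G` covering all vertices outside `D`. -/
theorem canForce_dominator_of_matching [Finite V] {M : V → V → Prop}
    (hsymm : ∀ a b, M a b → M b a) (huniq : ∀ a b b', M a b → M a b' → b = b')
    (hadj : ∀ a b, M a b → G.Adj a b) (hcov : ∀ y ∉ D, ∃ b, M y b) (p : Position V)
    (hp : Disjoint p.staller p.dominator)
    (hinv : ∀ a b, M a b → a ∈ p.staller → b ∈ p.dominator) :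
    CanForce G D .dominator .staller p := by
  induction hn : {v | p.Unclaimed v}.ncard using Nat.strong_induction_on generalizing p with
  | _ n ih =>
  have key : ∀ q : Position V, (∀ v, ¬ q.Unclaimed v) →
      (∀ a b, M a b → a ∈ q.staller → b ∈ q.dominator) → Achieved G D .dominator q := by
    intro q hq hi y hy
    obtain ⟨b, hb⟩ := hcov y hy
    by_cases h : y ∈ q.staller
    · exact ⟨b, Or.inr (hadj _ _ hb), hi _ _ hb h⟩
    · exact ⟨y, Or.inl rfl, by_contra fun h' => hq y ⟨h, h'⟩⟩
  by_cases hex : ∃ v, p.Unclaimed v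
  swap
  · exact .achieved (key p (not_exists.1 hex) hinv)
  refine .opponentMove (by simp) hex fun u hu => ?_
  have hcu := ncard_unclaimed_claim_lt hu .staller
  have hd' : Disjoint (p.claim .staller u).staller (p.claim .staller u).dominator :=
    Set.disjoint_insert_left.2 ⟨hu.2, hp⟩
  have step : ∀ w, (p.claim .staller u).Unclaimed w →
      (∀ b, M u b → b = w ∨ b ∈ p.dominator) →
      CanForce G D .dominator .dominator (p.claim .staller u) := by
    intro w hw hb
    refine .ownMove (t' := .staller) w rfl (by simp) hw ?_
    refine ih _ ?_ _ (Set.disjoint_insert_right.2 ⟨hw.1, hd'⟩) ?_ rfl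
    · rw [← hn]
      exact (ncard_unclaimed_claim_lt hw .dominator).trans hcu
    · rintro a b hab (rfl | ha)
      · rcases hb b hab with rfl | h
        · exact Set.mem_insert _ _
        · exact Set.mem_insert_of_mem _ h
      · exact Set.mem_insert_of_mem _ (hinv a b hab ha)
  by_cases hb : ∃ b, M u b ∧ p.Unclaimed b
  · obtain ⟨b, hb, hbu⟩ := hb
    exact step b (unclaimed_claim_iff.2 ⟨(hadj _ _ hb).ne', hbu⟩) fun b' hb' =>
      Or.inl (huniq _ _ _ hb' hb)
  -- If Staller owned the partner of `u`, the invariant would already have given `u` to Dominator.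
  -- So the partner is Dominator's, and he may reply anywhere.
  · have hdom : ∀ b, M u b → b ∈ p.dominator := by
      intro b hub
      by_contra h
      by_cases hs : b ∈ p.staller
      · exact hu.2 (hinv _ _ (hsymm _ _ hub) hs)
      · exact hb ⟨b, hub, hs, h⟩
    by_cases hw : ∃ w, (p.claim .staller u).Unclaimed w
    · obtain ⟨w, hw⟩ := hw
      exact step w hw fun b hb => Or.inr (hdom b hb)
    · refine .achieved (key _ (not_exists.1 hw) ?_)
      rintro a b hab (rfl | ha)
      · exact hdom b hab
      · exact hinv a b hab ha

theorem dominatorWins_of_matching [Finite V] {M : V → V → Prop}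
    (hsymm : ∀ a b, M a b → M b a) (huniq : ∀ a b b', M a b → M a b' → b = b')
    (hadj : ∀ a b, M a b → G.Adj a b) (hcov : ∀ y ∉ D, ∃ b, M y b) : DominatorWins G D :=
  canForce_dominator_of_matching hsymm huniq hadj hcov _ (by simp [Position.start])
    (by simp [Position.start])

open Classical in
/-- Staller's forcing strategy: `X` are the vertices whose neighborhoods are still untouched by
Dominator, and `B` contains the unclaimed vertices in these neighborhoods. -/
theorem canForce_staller_of_card_lt (X B : Finset V) (hcard : B.card < X.card)
    (hdeg : ∀ b ∈ B, (X.filter (G.Adj b)).card ≤ 2) (p : Position V)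
    (hX : ∀ x ∈ X, x ∉ D ∧ p.Unclaimed x)
    (hB : ∀ b ∈ B, p.Unclaimed b ∧ b ∉ X)
    (hN : ∀ x ∈ X, ∀ b, G.Adj x b → b ∈ p.staller ∨ b ∈ B) :
    CanForce G D .staller .staller p := by
  induction hn : X.card using Nat.strong_induction_on generalizing X B p with
  | _ n ih =>
  -- Double counting: each vertex of `B` has at most two neighbors in `X`, and `|B| < |X|`.
  obtain ⟨x, hx, hx1⟩ : ∃ x ∈ X, (B.filter (G.Adj x)).card ≤ 1 := by
    by_contra! h
    have h1 : X.card * 2 ≤ B.card * 2 := by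
      refine Finset.card_mul_le_card_mul G.Adj (fun a ha => h a ha) fun b hb => ?_
      convert hdeg b hb using 3
      ext y
      simp [Finset.bipartiteBelow, G.adj_comm]
    omega
  have hwin : ∀ q : Position V, q.Unclaimed x → (∀ b, G.Adj x b → b ∈ q.staller) →
      CanForce G D .staller .staller q := by
    intro q hq hb
    refine .ownMove (t' := .dominator) x rfl (by simp) hq (.achieved ⟨x, (hX x hx).1, ?_⟩)
    rintro b (rfl | h)
    · exact Set.mem_insert _ _
    · exact Set.mem_insert_of_mem _ (hb b h)
  by_cases h0 : ∃ u ∈ B, G.Adj x u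
  swap
  · push Not at h0
    exact hwin p (hX x hx).2 fun b hb => (hN x hx b hb).resolve_right fun h => h0 b h hb
  obtain ⟨u, huB, hxu⟩ := h0
  have hu_only : ∀ b ∈ B, G.Adj x b → b = u := fun b hb hxb =>
    Finset.card_le_one.1 hx1 b (by simp [hb, hxb]) u (by simp [huB, hxu])
  -- Claiming `u` threatens to complete the closed neighborhood of `x`, so Dominator must answer
  -- `x`. Removing `x` from `X` and `u` from `B` preserves the inequality of cardinalities.
  refine .ownMove (t' := .dominator) u rfl (by simp) (hB u huB).1 ?_
  have hxq : (p.claim .staller u).Unclaimed x := unclaimed_claim_iff.2 ⟨hxu.ne, (hX x hx).2⟩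
  refine .opponentMove (by simp) ⟨x, hxq⟩ fun w hw => ?_
  have hxcl : ∀ b, G.Adj x b → b ∈ ((p.claim .staller u).claim .dominator w).staller := by
    intro b hb
    rcases hN x hx b hb with h | h
    · exact Set.mem_insert_of_mem _ h
    · rw [hu_only b h hb]
      exact Set.mem_insert _ _
  by_cases hwx : w = x
  swap
  · exact hwin _ (unclaimed_claim_iff.2 ⟨Ne.symm hwx, hxq⟩) hxcl
  subst hwx
  have hcX := Finset.card_erase_add_one hx
  have hcB := Finset.card_erase_add_one huB
  refine ih (X.erase w).card (by omega) (X.erase w) (B.erase u) (by omega) ?_ _ ?_ ?_ ?_ rfl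
  · intro b hb
    refine le_trans (Finset.card_le_card ?_) (hdeg b (Finset.mem_of_mem_erase hb))
    exact Finset.filter_subset_filter _ (Finset.erase_subset _ _)
  · intro y hy
    rw [Finset.mem_erase] at hy
    refine ⟨(hX y hy.2).1, unclaimed_claim_iff.2 ⟨hy.1, unclaimed_claim_iff.2 ⟨?_, (hX y hy.2).2⟩⟩⟩
    rintro rfl
    exact (hB _ huB).2 hy.2
  · intro b hb
    rw [Finset.mem_erase] at hb
    refine ⟨unclaimed_claim_iff.2 ⟨?_, unclaimed_claim_iff.2 ⟨hb.1, (hB b hb.2).1⟩⟩, ?_⟩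
    · rintro rfl
      exact (hB _ hb.2).2 hx
    · exact fun h => (hB b hb.2).2 (Finset.mem_of_mem_erase h)
  · intro y hy b hb
    rcases hN y (Finset.mem_of_mem_erase hy) b hb with h | h
    · exact Or.inl (Set.mem_insert_of_mem _ h)
    · by_cases hbu : b = u
      · exact Or.inl (hbu ▸ Set.mem_insert _ _)
      · exact Or.inr (Finset.mem_erase.2 ⟨hbu, h⟩)

/-! ### Rooted trees, matchings and edge counts. -/

theorem eq_of_adj_of_dist_eq_succ {T : SimpleGraph V} (hT : T.IsTree) {r v a b : V}
    (ha : T.Adj v a) (hb : T.Adj v b) (hda : T.dist r v = T.dist r a + 1)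
    (hdb : T.dist r v = T.dist r b + 1) : a = b := by
  obtain ⟨p, hp, hpl⟩ := hT.connected.exists_path_of_dist r v
  have key : ∀ c, T.Adj v c → T.dist r v = T.dist r c + 1 → c = p.penultimate := by
    intro c hc hd
    refine hT.isAcyclic.eq_penultimate_of_adj_end hp hc ?_
    -- Off the geodesic `p`, the vertex `c` could only be reached by prolonging `p`, so it would be
    -- farther from `r` than `v`.
    by_contra hcp
    obtain ⟨q, hq, hql⟩ := hT.connected.exists_path_of_dist r c
    have hv := hT.isAcyclic.mem_support_of_ne_mem_support_of_adj_of_isPath hq hp hc.symm hcp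
    have h := congrArg SimpleGraph.Walk.length (hT.isAcyclic.path_concat hp hq hc hv)
    rw [SimpleGraph.Walk.length_concat] at h
    omega
  rw [key a ha hda, key b hb hdb]

theorem eq_of_common_neighbors {T : SimpleGraph V} (hT : T.IsTree) {x y b b' : V} (hxy : x ≠ y)
    (hxb : T.Adj x b) (hyb : T.Adj y b) (hxb' : T.Adj x b') (hyb' : T.Adj y b') : b = b' := by
  have h1 : T.dist x b = 1 := SimpleGraph.dist_eq_one_iff_adj.2 hxb
  have h1' : T.dist x b' = 1 := SimpleGraph.dist_eq_one_iff_adj.2 hxb'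
  have h0 : T.dist x y ≠ 0 := fun h => hxy (hT.connected.dist_eq_zero_iff.1 h)
  have h2 := hT.dist_eq_dist_add_one_of_adj x hyb
  exact eq_of_adj_of_dist_eq_succ (r := x) hT hyb hyb' (by omega) (by omega)

/-- In a graph with a two-coloring, a system of distinct neighbors for the vertices of `Y` can be
turned into a matching covering `Y`. -/
theorem exists_matching_of_injOn {Y : Set V} (c : G.Coloring Bool) {h : V → V}
    (hinj : Set.InjOn h Y) (hadj : ∀ y ∈ Y, G.Adj y (h y)) :
    ∃ M : V → V → Prop, (∀ a b, M a b → M b a) ∧ (∀ a b b', M a b → M a b' → b = b') ∧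
      (∀ a b, M a b → G.Adj a b) ∧ ∀ y ∈ Y, ∃ b, M y b := by
  -- `R` consists of the vertices on chains of `h` that start in a vertex colored `true`
  let R : V → Prop := fun v => ∀ S : Set V,
    (∀ a ∈ Y, c a = true → a ∉ h '' Y → a ∈ S) → (∀ a ∈ Y, a ∈ S → h a ∈ S) → v ∈ S
  have R_start : ∀ a ∈ Y, c a = true → a ∉ h '' Y → R a := fun a ha hc hh S h1 _ => h1 a ha hc hh
  have R_step : ∀ a ∈ Y, R a → R (h a) := fun a ha hR S h1 h2 => h2 a ha (hR S h1 h2)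
  have R_inv : ∀ a ∈ Y, R (h a) → R a := by
    intro a ha hR
    refine (hR {v | R v ∧ ∀ a ∈ Y, v = h a → R a} ?_ ?_).2 a ha rfl
    · intro u hu hcu huh
      exact ⟨R_start u hu hcu huh, fun a ha hau => absurd ⟨a, ha, hau.symm⟩ huh⟩
    · intro u hu hRu
      refine ⟨R_step u hu hRu.1, fun a ha hau => ?_⟩
      rw [← hinj hu ha hau]
      exact hRu.1
  have color : ∀ y ∈ Y, c (h y) = !(c y) := by
    intro y hy
    have := c.valid (hadj y hy)
    revert this
    cases c y <;> cases c (h y) <;> simp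
  -- The color alternates along each chain of `h`, so keeping the edges `a → h a` at one color
  -- selects every second edge. Chains starting at a `true` vertex keep the edges leaving `true`
  -- vertices; all others, cycles included, keep those leaving `false` vertices. Thus a starting
  -- vertex always keeps its outgoing edge.
  let E : V → Prop := fun v => v ∈ Y ∧ (c v = true ↔ R v)
  have disj : ∀ a b, E a → E b → h a ≠ b := by
    rintro a b ⟨ha, hEa⟩ ⟨hb, hEb⟩ rfl
    have h1 := color a ha
    have h2 : R (h a) ↔ R a := ⟨R_inv a ha, R_step a ha⟩
    rw [h2, ← hEa, h1] at hEb
    cases hc : c a <;> simp [hc] at hEb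
  refine ⟨fun a b => (E a ∧ h a = b) ∨ (E b ∧ h b = a), ?_, ?_, ?_, ?_⟩
  · rintro a b (h1 | h1)
    · exact Or.inr h1
    · exact Or.inl h1
  · rintro a b b' (⟨h1, h2⟩ | ⟨h1, h2⟩) (⟨h3, h4⟩ | ⟨h3, h4⟩)
    · exact h2.symm.trans h4
    · exact absurd h4 (disj _ _ h3 h1)
    · exact absurd h2 (disj _ _ h1 h3)
    · exact hinj h1.1 h3.1 (h2.trans h4.symm)
  · rintro a b (⟨h1, rfl⟩ | ⟨h1, rfl⟩)
    · exact hadj _ h1.1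
    · exact (hadj _ h1.1).symm
  · intro y hy
    by_cases hE : c y = true ↔ R y
    · exact ⟨h y, Or.inl ⟨⟨hy, hE⟩, rfl⟩⟩
    · have hmem : y ∈ h '' Y := by
        by_contra hyh
        apply hE
        refine ⟨fun hc => R_start y hy hc hyh, fun hR => ?_⟩
        refine (hR {v | v ∈ h '' Y ∨ c v = true} ?_ ?_).resolve_left hyh
        · exact fun a _ hc _ => Or.inr hc
        · exact fun a ha _ => Or.inl ⟨a, ha, rfl⟩
      obtain ⟨a, ha, rfl⟩ := hmem
      refine ⟨a, Or.inr ⟨⟨ha, ?_⟩, rfl⟩⟩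
      have h1 := color a ha
      have h2 : R (h a) ↔ R a := ⟨R_inv a ha, R_step a ha⟩
      rw [h2, h1] at hE
      by_cases hR : R a <;> cases hc : c a <;> simp_all

open Classical in
/-- A tree has fewer edges between disjoint vertex sets `X` and `N` than there are vertices in
their union. -/
theorem sum_card_filter_adj_lt {T : SimpleGraph V} (hT : T.IsTree) {X N : Finset V}
    (hXN : Disjoint X N) (hne : X.Nonempty) :
    ∑ b ∈ N, (X.filter (T.Adj b)).card < X.card + N.card := by
  obtain ⟨r, hr⟩ := hne
  rw [← Finset.card_sigma, ← Finset.card_union_of_disjoint hXN]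
  refine lt_of_le_of_lt ?_ (Finset.card_erase_lt_of_mem (Finset.mem_union_left N hr))
  -- Each edge is sent to its endpoint farther from `r`. A vertex has only one neighbor closer to
  -- the root, and `r` itself is never hit.
  refine Finset.card_le_card_of_injOn
    (fun e => if T.dist r e.2 = T.dist r e.1 + 1 then e.2 else e.1) ?_ ?_
  · rintro ⟨b, x⟩ h
    simp only [Finset.coe_sigma, Set.mem_sigma_iff, Finset.mem_coe, Finset.mem_filter] at h
    obtain ⟨hb, hx, hbx⟩ := h
    have h1 := hT.dist_eq_dist_add_one_of_adj r hbx
    have h0 : T.dist r r = 0 := T.dist_self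
    simp only [Finset.coe_erase, Finset.coe_union, Set.mem_sdiff, Set.mem_union, Finset.mem_coe,
      Set.mem_singleton_iff]
    split_ifs with h
    · exact ⟨Or.inl hx, by rintro rfl; omega⟩
    · exact ⟨Or.inr hb, by rintro rfl; omega⟩
  · rintro ⟨b, x⟩ h ⟨b', x'⟩ h' heq
    simp only [Finset.coe_sigma, Set.mem_sigma_iff, Finset.mem_coe, Finset.mem_filter] at h h'
    obtain ⟨hb, hx, hbx⟩ := h
    obtain ⟨hb', hx', hbx'⟩ := h'
    have h1 := hT.dist_eq_dist_add_one_of_adj r hbx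
    have h1' := hT.dist_eq_dist_add_one_of_adj r hbx'
    simp only at heq
    split_ifs at heq with h2 h3 h3
    · subst heq
      rw [eq_of_adj_of_dist_eq_succ hT hbx.symm hbx'.symm h2 h3]
    · exact absurd (heq ▸ hb') (Finset.disjoint_left.1 hXN hx)
    · exact absurd (heq ▸ hb) (Finset.disjoint_left.1 hXN hx')
    · subst heq
      rw [eq_of_adj_of_dist_eq_succ (r := r) hT hbx hbx' (by omega) (by omega)]

/-! ### Minimal violators of Hall's condition. -/

section Hall

variable [Fintype V]

open Classical in
/-- The set of all vertices with a neighbor in `X`. -/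
noncomputable def nbrs (G : SimpleGraph V) (X : Finset V) : Finset V := {b | ∃ x ∈ X, G.Adj x b}

theorem mem_nbrs {X : Finset V} {b : V} : b ∈ nbrs G X ↔ ∃ x ∈ X, G.Adj x b := by
  simp [nbrs]

theorem nbrs_mono {X X' : Finset V} (h : X ⊆ X') : nbrs G X ⊆ nbrs G X' := by
  intro b hb
  obtain ⟨x, hx, hxb⟩ := mem_nbrs.1 hb
  exact mem_nbrs.2 ⟨x, h hx, hxb⟩

/-- `X` is a set of vertices of `Y` violating Hall's condition. -/
def HallViolator (G : SimpleGraph V) (Y : Set V) (X : Finset V) : Prop :=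
  ↑X ⊆ Y ∧ (nbrs G X).card < X.card

open Classical in
theorem exists_injOn_or_minimal_hallViolator (G : SimpleGraph V) (Y : Set V) :
    (∃ h : V → V, Set.InjOn h Y ∧ ∀ y ∈ Y, G.Adj y (h y)) ∨
      ∃ X, Minimal (HallViolator G Y) X := by
  by_cases hall : ∀ A : Finset Y, A.card ≤ (Finset.univ.filter fun b => ∃ a ∈ A, G.Adj a b).card
  · left
    obtain ⟨f, hf, hfa⟩ := (Fintype.all_card_le_filter_rel_iff_exists_injective
      (fun (a : Y) b => G.Adj a b)).1 hall
    refine ⟨fun v => if hv : v ∈ Y then f ⟨v, hv⟩ else v, ?_, ?_⟩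
    · intro a ha b hb hab
      simp only [ha, hb, dif_pos] at hab
      exact congrArg Subtype.val (hf hab)
    · intro y hy
      simpa only [hy, dif_pos] using hfa ⟨y, hy⟩
  · right
    push Not at hall
    obtain ⟨A, hA⟩ := hall
    have : HallViolator G Y (A.map (Function.Embedding.subtype _)) := by
      refine ⟨?_, ?_⟩
      · intro x hx
        simp only [Finset.coe_map, Set.mem_image] at hx
        obtain ⟨a, _, rfl⟩ := hx
        exact a.2
      · rw [Finset.card_map]
        refine lt_of_eq_of_lt (congrArg Finset.card ?_) hA
        ext b
        simp [mem_nbrs]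
    obtain ⟨X, -, hX⟩ := exists_minimal_le_of_wellFoundedLT _ _ this
    exact ⟨X, hX⟩

variable {Y : Set V} {X : Finset V}

theorem HallViolator.eq_of_subset (hX : Minimal (HallViolator G Y) X) {S : Finset V} (hS : S ⊆ X)
    (hc : (nbrs G S).card < S.card) : S = X :=
  hS.antisymm (hX.le_of_le ⟨(Finset.coe_subset.2 hS).trans hX.prop.1, hc⟩ hS)

theorem HallViolator.nonempty (hX : HallViolator G Y X) : X.Nonempty :=
  Finset.card_pos.1 ((Nat.zero_le _).trans_lt hX.2)

-- The neighborhoods of `S` and `X \ S` are disjoint, so one of the two parts is itself a violator;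
-- by minimality the other is empty.
open Classical in
theorem HallViolator.eq_of_separated (hX : Minimal (HallViolator G Y) X) {S : Finset V}
    (hS : S ⊆ X) (hne : S.Nonempty)
    (hsep : ∀ s ∈ S, ∀ x ∈ X, x ∉ S → ∀ b, G.Adj s b → ¬ G.Adj x b) : S = X := by
  have hdisj : Disjoint (nbrs G S) (nbrs G (X \ S)) := by
    rw [Finset.disjoint_left]
    intro b h1 h2
    obtain ⟨s, hs, hsb⟩ := mem_nbrs.1 h1
    obtain ⟨x, hx, hxb⟩ := mem_nbrs.1 h2
    rw [Finset.mem_sdiff] at hx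
    exact hsep s hs x hx.1 hx.2 b hsb hxb
  have h1 : (nbrs G S).card + (nbrs G (X \ S)).card ≤ (nbrs G X).card := by
    rw [← Finset.card_union_of_disjoint hdisj]
    exact Finset.card_le_card (Finset.union_subset (nbrs_mono hS) (nbrs_mono Finset.sdiff_subset))
  have h2 := Finset.card_sdiff_add_card_eq_card hS
  have h3 := hX.prop.2
  by_cases h : (nbrs G S).card < S.card
  · exact eq_of_subset hX hS h
  · have h4 := eq_of_subset hX (S := X \ S) Finset.sdiff_subset (by omega)
    have h5 := hne.card_pos
    rw [h4] at h2
    omega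

-- If `b` had a single neighbor `x` in `X`, removing `x` would also remove `b` from the neighborhood
-- and leave a smaller violator.
open Classical in
theorem HallViolator.two_le_card_filter (hX : Minimal (HallViolator G Y) X) {b : V}
    (hb : b ∈ nbrs G X) : 2 ≤ (X.filter (G.Adj b)).card := by
  by_contra! h
  obtain ⟨x, hx, hxb⟩ := mem_nbrs.1 hb
  have hsub : nbrs G (X.erase x) ⊆ (nbrs G X).erase b := by
    intro b' hb'
    refine Finset.mem_erase.2 ⟨?_, nbrs_mono (Finset.erase_subset _ _) hb'⟩
    rintro rfl
    obtain ⟨y, hy, hyb⟩ := mem_nbrs.1 hb'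
    rw [Finset.mem_erase] at hy
    exact hy.1 (Finset.card_le_one.1 (Nat.le_of_lt_succ h) y (by simp [hy.2, hyb.symm]) x
      (by simp [hx, hxb.symm]))
  have h1 := Finset.card_le_card hsub
  have h2 := Finset.card_erase_add_one hb
  have h3 := Finset.card_erase_add_one hx
  have h4 := hX.prop.2
  have h5 := eq_of_subset hX (Finset.erase_subset x X) (by omega)
  exact Finset.erase_eq_self.1 h5 hx

open Classical in
theorem HallViolator.card_eq (hX : Minimal (HallViolator G Y) X) :
    (nbrs G X).card + 1 = X.card := by
  obtain ⟨x, hx⟩ := nonempty hX.prop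
  have h1 := Finset.card_le_card (nbrs_mono (G := G) (Finset.erase_subset x X))
  have h3 := Finset.card_erase_add_one hx
  have h4 := hX.prop.2
  by_contra h
  have h5 := eq_of_subset hX (Finset.erase_subset x X) (by omega)
  exact Finset.erase_eq_self.1 h5 hx

-- The color classes of `X` have neighborhoods of opposite colors, hence disjoint, so `X` is
-- monochromatic.
open Classical in
theorem HallViolator.not_adj (hX : Minimal (HallViolator G Y) X) (c : G.Coloring Bool) {x y : V}
    (hx : x ∈ X) (hy : y ∈ X) : ¬ G.Adj x y := by
  have h : X.filter (fun z => c z = c x) = X := by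
    refine eq_of_separated hX (Finset.filter_subset _ _) ⟨x, by simp [hx]⟩ ?_
    intro s hs z hz hzS b hsb hzb
    rw [Finset.mem_filter] at hs
    have h1 := c.valid hsb
    have h2 := c.valid hzb
    have h3 : c z ≠ c x := fun h => hzS (by simp [hz, h])
    rw [hs.2] at h1
    revert h1 h2 h3
    cases c z <;> cases c x <;> cases c b <;> simp
  intro hadj
  rw [← h, Finset.mem_filter] at hy
  exact c.valid hadj hy.2.symm

-- The edges between `X` and `N(X)` number at least `2|N(X)|` and fewer than `|X| + |N(X)| = 2|N(X)|
-- + 1`, so equality holds at every vertex.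
open Classical in
theorem HallViolator.card_filter_eq_two {T : SimpleGraph V} (hT : T.IsTree)
    (hX : Minimal (HallViolator T Y) X) (hind : ∀ x ∈ X, ∀ y ∈ X, ¬ T.Adj x y) {b : V}
    (hb : b ∈ nbrs T X) : (X.filter (T.Adj b)).card = 2 := by
  have hdisj : Disjoint X (nbrs T X) := by
    rw [Finset.disjoint_left]
    intro x hx hxN
    obtain ⟨y, hy, hyx⟩ := mem_nbrs.1 hxN
    exact hind y hy x hx hyx
  have h1 := sum_card_filter_adj_lt hT hdisj (nonempty hX.prop)
  have h2 := card_eq hX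
  have hle : ∀ b ∈ nbrs T X, 2 ≤ (X.filter (T.Adj b)).card := fun b => two_le_card_filter hX
  have h3 := Finset.sum_le_sum hle
  have h4 : ∑ b ∈ nbrs T X, 2 = (nbrs T X).card * 2 := by simp
  exact ((Finset.sum_eq_sum_iff_of_le hle).1 (by omega) b hb).symm

end Hall

/-! ### From Hall violators in trees to substructures. -/

theorem exists_coloring_bool {T : SimpleGraph V} (hT : T.IsTree) : Nonempty (T.Coloring Bool) :=
  ⟨(T.recolorOfEquiv finTwoEquiv) hT.colorable_two.some⟩

theorem dominatorWins_or_minimal_hallViolator [Fintype V] {T : SimpleGraph V} (hT : T.IsTree)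
    (D : Set V) : DominatorWins T D ∨ ∃ X, Minimal (HallViolator T Dᶜ) X := by
  refine (exists_injOn_or_minimal_hallViolator T Dᶜ).imp_left ?_
  rintro ⟨h, hinj, hadj⟩
  obtain ⟨c⟩ := exists_coloring_bool hT
  obtain ⟨M, h1, h2, h3, h4⟩ := exists_matching_of_injOn c hinj hadj
  exact dominatorWins_of_matching h1 h2 h3 h4

-- Joining two vertices of `X` when they have a common neighbor gives a graph `H` whose edges
-- correspond to `N(X)`. It is connected by `eq_of_separated` and has `|X| - 1` edges, hence is a
-- tree. The subgraph `F` keeps every edge of `T` meeting `X`, so degrees on `X` agree.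
open Classical in
theorem HallViolator.exists_isSubstructure [Fintype V] {Y : Set V} {X : Finset V}
    {T : SimpleGraph V} (hT : T.IsTree) (hX : Minimal (HallViolator T Y) X) :
    ∃ (F : T.Subgraph) (Z : Set F.verts), IsSubstructure T F Z ∧ Subtype.val '' Z = (X : Set V) := by
  obtain ⟨c⟩ := exists_coloring_bool hT
  have hind : ∀ x ∈ X, ∀ y ∈ X, ¬ T.Adj x y := fun x hx y hy => not_adj hX c hx hy
  let H : SimpleGraph X :=
    { Adj := fun x y => x ≠ y ∧ ∃ b, T.Adj x b ∧ T.Adj y b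
      symm := ⟨fun x y ⟨h, b, h1, h2⟩ => ⟨h.symm, b, h2, h1⟩⟩
      loopless := ⟨fun x h => h.1 rfl⟩ }
  have hends : ∀ (x y : X) b, x ≠ y → T.Adj x b → T.Adj y b →
      ∀ w : X, w ∈ s(x, y) ↔ T.Adj w b := by
    intro x y b hxy hx hy w
    have h2 := card_filter_eq_two hT hX hind (mem_nbrs.2 ⟨x, x.2, hx⟩)
    have h3 : ({(x : V), (y : V)} : Finset V) = X.filter (T.Adj b) := by
      refine Finset.eq_of_subset_of_card_le ?_ ?_
      · intro z hz
        rw [Finset.mem_insert, Finset.mem_singleton] at hz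
        rcases hz with rfl | rfl
        · simp [hx.symm]
        · simp [hy.symm]
      · rw [h2, Finset.card_pair (fun h => hxy (Subtype.ext h))]
    have h4 := Finset.ext_iff.1 h3 w
    simp only [Finset.mem_insert, Finset.mem_singleton, Finset.mem_filter, w.2, true_and] at h4
    rw [Sym2.mem_iff, T.adj_comm, ← h4, Subtype.ext_iff, Subtype.ext_iff]
  have hmid : ∀ e : H.edgeSet, ∃ b, ∀ w : X, w ∈ (e : Sym2 X) ↔ T.Adj w b := by
    rintro ⟨e, he⟩
    induction e using Sym2.ind with
    | _ x y =>
      obtain ⟨hxy, b, hx, hy⟩ := he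
      exact ⟨b, hends x y b hxy hx hy⟩
  choose mid hmid using hmid
  have hmid_adj : ∀ e : H.edgeSet, ∃ x y : X, x ≠ y ∧ T.Adj x (mid e) ∧ T.Adj y (mid e) := by
    rintro ⟨e, he⟩
    induction e using Sym2.ind with
    | _ x y => exact ⟨x, y, (H.mem_edgeSet.1 he).ne, (hmid _ x).1 (by simp), (hmid _ y).1 (by simp)⟩
  have hmid_nbrs : ∀ e, mid e ∈ nbrs T X := by
    intro e
    obtain ⟨x, _, _, hx, _⟩ := hmid_adj e
    exact mem_nbrs.2 ⟨x, x.2, hx⟩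
  have hmid_notMem : ∀ e, mid e ∉ X := by
    intro e he
    obtain ⟨x, _, _, hx, _⟩ := hmid_adj e
    exact hind x x.2 _ he hx
  have hmid_inj : Function.Injective mid := by
    intro e e' h
    refine Subtype.ext (Sym2.ext fun w => ?_)
    rw [hmid, hmid, h]
  have hmid_surj : ∀ b ∈ nbrs T X, ∃ e, mid e = b := by
    intro b hb
    obtain ⟨x, y, hxy, hf⟩ := Finset.card_eq_two.1 (card_filter_eq_two hT hX hind hb)
    have hx : x ∈ X.filter (T.Adj b) := by simp [hf]
    have hy : y ∈ X.filter (T.Adj b) := by simp [hf]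
    rw [Finset.mem_filter] at hx hy
    let x' : X := ⟨x, hx.1⟩
    let y' : X := ⟨y, hy.1⟩
    have he : s(x', y') ∈ H.edgeSet :=
      ⟨fun h => hxy (congrArg Subtype.val h), b, hx.2.symm, hy.2.symm⟩
    refine ⟨⟨_, he⟩, eq_of_common_neighbors hT hxy ?_ ?_ hx.2.symm hy.2.symm⟩
    · exact (hmid ⟨_, he⟩ x').1 (by simp)
    · exact (hmid ⟨_, he⟩ y').1 (by simp)
  have hconn : H.Connected := by
    obtain ⟨r, hr⟩ := nonempty hX.prop
    have : Nonempty X := ⟨⟨r, hr⟩⟩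
    refine (SimpleGraph.connected_iff_exists_forall_reachable H).2 ⟨⟨r, hr⟩, ?_⟩
    have hS : X.filter (fun x => ∃ hx : x ∈ X, H.Reachable ⟨r, hr⟩ ⟨x, hx⟩) = X := by
      refine eq_of_separated hX (Finset.filter_subset _ _) ⟨r, ?_⟩ ?_
      · exact Finset.mem_filter.2 ⟨hr, hr, SimpleGraph.Reachable.refl _⟩
      · intro s hs x hx hxS b hsb hxb
        obtain ⟨-, hs, hrs⟩ := Finset.mem_filter.1 hs
        refine hxS (Finset.mem_filter.2 ⟨hx, hx, ?_⟩)
        by_cases hsx : s = x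
        · subst hsx
          exact hrs
        · have hadj : H.Adj ⟨s, hs⟩ ⟨x, hx⟩ :=
            ⟨fun h => hsx (congrArg Subtype.val h), b, hsb, hxb⟩
          exact hrs.trans hadj.reachable
    rintro ⟨x, hx⟩
    rw [← hS, Finset.mem_filter] at hx
    exact hx.2.2
  have hHT : H.IsTree := by
    refine SimpleGraph.isTree_iff_connected_and_card.2 ⟨hconn, ?_⟩
    have h1 : Nat.card H.edgeSet = Nat.card (nbrs T X) := by
      refine Nat.card_eq_of_bijective (fun e => ⟨mid e, hmid_nbrs e⟩) ⟨?_, ?_⟩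
      · exact fun e e' h => hmid_inj (congrArg Subtype.val h)
      · rintro ⟨b, hb⟩
        obtain ⟨e, he⟩ := hmid_surj b hb
        exact ⟨e, Subtype.ext he⟩
    rw [h1, Nat.card_eq_fintype_card, Nat.card_eq_fintype_card, Fintype.card_coe,
      Fintype.card_coe, card_eq hX]
  let F : T.Subgraph :=
    { verts := {v | v ∈ X ∨ v ∈ nbrs T X}
      Adj := fun a b => T.Adj a b ∧ (a ∈ X ∨ b ∈ X)
      adj_sub := fun h => h.1
      edge_vert := fun {a b} h =>
        h.2.imp_right fun hb => mem_nbrs.2 ⟨b, hb, h.1.symm⟩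
      symm := ⟨fun a b h => ⟨h.1.symm, h.2.symm⟩⟩ }
  let φ₀ : X ⊕ H.edgeSet → F.verts :=
    Sum.elim (fun x => ⟨x, Or.inl x.2⟩) (fun e => ⟨mid e, Or.inr (hmid_nbrs e)⟩)
  have hφ₀ : Function.Bijective φ₀ := by
    refine ⟨?_, ?_⟩
    · rintro (x | e) (y | e') h
      · have h' : (x : V) = y := congrArg (Subtype.val : F.verts → V) h
        exact congrArg Sum.inl (Subtype.ext h')
      · have h' : (x : V) = mid e' := congrArg Subtype.val h
        exact absurd (h' ▸ x.2) (hmid_notMem e')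
      · have h' : mid e = (y : V) := congrArg Subtype.val h
        exact absurd (h' ▸ y.2) (hmid_notMem e)
      · exact congrArg Sum.inr (hmid_inj (congrArg Subtype.val h))
    · rintro ⟨v, hv | hv⟩
      · exact ⟨Sum.inl ⟨v, hv⟩, rfl⟩
      · obtain ⟨e, rfl⟩ := hmid_surj v hv
        exact ⟨Sum.inr e, rfl⟩
  let φ : subdivision H ≃g F.coe :=
    { toEquiv := Equiv.ofBijective φ₀ hφ₀
      map_rel_iff' := by
        rintro (x | e) (y | e')
        · change (T.Adj x y ∧ ((x : V) ∈ X ∨ (y : V) ∈ X)) ↔ False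
          exact iff_of_false (fun h => hind x x.2 y y.2 h.1) id
        · change (T.Adj x (mid e') ∧ ((x : V) ∈ X ∨ mid e' ∈ X)) ↔ x ∈ (e' : Sym2 X)
          simp [hmid]
        · change (T.Adj (mid e) y ∧ (mid e ∈ X ∨ (y : V) ∈ X)) ↔ y ∈ (e : Sym2 X)
          simp [hmid, T.adj_comm]
        · change (T.Adj (mid e) (mid e') ∧ (mid e ∈ X ∨ mid e' ∈ X)) ↔ False
          simp [hmid_notMem] }
  refine ⟨F, Set.range fun w : X => φ (Sum.inl w), ⟨⟨X, inferInstance, H, hHT, φ, rfl⟩, ?_⟩, ?_⟩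
  · rintro _ ⟨x, rfl⟩
    have h : F.neighborSet (x : V) = T.neighborSet x := by
      ext b
      exact ⟨fun h => h.1, fun h => ⟨h, Or.inl x.2⟩⟩
    exact congrArg Set.ncard h.symm
  · rw [← Set.range_comp]
    change Set.range (Subtype.val : X → V) = _
    simp

/-! ### Subdivided trees embedded with full neighborhoods at the original vertices. -/

section Realization

variable {W : Type v} {H : SimpleGraph W} {f : W → V} {g : H.edgeSet → V}

theorem stallerWins_of_realization [Finite W] (hH : H.IsTree) (hf : Function.Injective f)
    (hfg : ∀ w e, f w ≠ g e) (hg : Function.Injective g)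
    (hadj : ∀ w b, G.Adj (f w) b ↔ ∃ e : H.edgeSet, w ∈ (e : Sym2 W) ∧ g e = b)
    (hD : ∀ w, f w ∉ D) : StallerWins G D := by
  classical
  have := Fintype.ofFinite W
  refine canForce_staller_of_card_lt (Finset.univ.image f) (Finset.univ.image g) ?_ ?_ _ ?_ ?_ ?_
  · rw [Finset.card_image_of_injective _ hf, Finset.card_image_of_injective _ hg,
      Finset.card_univ, Finset.card_univ, ← Nat.card_eq_fintype_card, ← Nat.card_eq_fintype_card,
      ← (SimpleGraph.isTree_iff_connected_and_card.1 hH).2]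
    exact Nat.lt_succ_self _
  · intro b hb
    obtain ⟨⟨e, he⟩, -, rfl⟩ := Finset.mem_image.1 hb
    induction e using Sym2.ind with
    | _ x y =>
      refine le_trans (Finset.card_le_card (t := {f x, f y}) ?_) Finset.card_le_two
      intro z hz
      obtain ⟨hz, hzb⟩ := Finset.mem_filter.1 hz
      obtain ⟨w, -, rfl⟩ := Finset.mem_image.1 hz
      obtain ⟨e', hwe, he'⟩ := (hadj w _).1 hzb.symm
      rw [hg he', Sym2.mem_iff] at hwe
      rcases hwe with rfl | rfl <;> simp
  · intro x hx
    obtain ⟨w, -, rfl⟩ := Finset.mem_image.1 hx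
    exact ⟨hD w, by simp [Position.Unclaimed, Position.start]⟩
  · intro b hb
    obtain ⟨e, -, rfl⟩ := Finset.mem_image.1 hb
    refine ⟨by simp [Position.Unclaimed, Position.start], fun h => ?_⟩
    obtain ⟨w, -, h⟩ := Finset.mem_image.1 h
    exact hfg w e h
  · intro x hx b hxb
    obtain ⟨w, -, rfl⟩ := Finset.mem_image.1 hx
    obtain ⟨e, -, rfl⟩ := (hadj w b).1 hxb
    exact Or.inr (Finset.mem_image_of_mem _ (Finset.mem_univ e))

/-- A violator inside `Y` misses `f w₀`, so some edge of the connected graph `H` leaves it; the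
midpoint of that edge has only one neighbor in the violator. -/
theorem not_minimal_hallViolator_of_realization [Fintype V] (hH : H.Connected)
    (hg : Function.Injective g)
    (hadj : ∀ w b, G.Adj (f w) b ↔ ∃ e : H.edgeSet, w ∈ (e : Sym2 W) ∧ g e = b)
    {Y : Set V} (hY : Y ⊆ Set.range f) {w₀ : W} (hw₀ : f w₀ ∉ Y) (X : Finset V) :
    ¬ Minimal (HallViolator G Y) X := by
  classical
  intro hX
  obtain ⟨x, hx⟩ := HallViolator.nonempty hX.prop
  obtain ⟨w₁, rfl⟩ := hY (hX.prop.1 hx)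
  obtain ⟨p⟩ := hH.preconnected w₁ w₀
  obtain ⟨d, -, h1, h2⟩ := p.exists_boundary_dart {w | f w ∈ X} hx fun h => hw₀ (hX.prop.1 h)
  let e : H.edgeSet := ⟨s(d.fst, d.snd), d.adj⟩
  have hb : g e ∈ nbrs G X := mem_nbrs.2 ⟨_, h1, (hadj _ _).2 ⟨e, Sym2.mem_mk_left _ _, rfl⟩⟩
  have h3 := HallViolator.two_le_card_filter hX hb
  have h4 : X.filter (G.Adj (g e)) ⊆ {f d.fst} := by
    intro z hz
    obtain ⟨hz, hzb⟩ := Finset.mem_filter.1 hz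
    obtain ⟨w, rfl⟩ := hY (hX.prop.1 hz)
    obtain ⟨e', hwe, he'⟩ := (hadj w _).1 hzb.symm
    rw [hg he', Sym2.mem_iff] at hwe
    rcases hwe with rfl | rfl
    · simp
    · exact absurd hz h2
  have h5 := Finset.card_le_card h4
  rw [Finset.card_singleton] at h5
  omega

end Realization

/-! ### Critical pairs and the main theorem. -/

theorem IsSubstructure.isCritical [Finite V] {T : SimpleGraph V} (hT : T.IsTree) {F : T.Subgraph}
    {X : Set F.verts} (h : IsSubstructure T F X) :
    IsCritical T (Set.univ \ (Subtype.val '' X)) := by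
  have := Fintype.ofFinite V
  obtain ⟨⟨W, hW, H, hH, φ, rfl⟩, hdeg⟩ := h
  let f : W → V := fun w => (φ (Sum.inl w) : F.verts)
  let g : H.edgeSet → V := fun e => (φ (Sum.inr e) : F.verts)
  have hval : Function.Injective fun z => ((φ z : F.verts) : V) :=
    Subtype.val_injective.comp φ.injective
  have hf : Function.Injective f := hval.comp Sum.inl_injective
  have hg : Function.Injective g := hval.comp Sum.inr_injective
  have hfg : ∀ w e, f w ≠ g e := fun w e h => Sum.inl_ne_inr (hval h)
  have hrange : Subtype.val '' (Set.range fun w : W => φ (Sum.inl w)) = Set.range f :=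
    (Set.range_comp _ _).symm
  have hadj : ∀ w b, T.Adj (f w) b ↔ ∃ e : H.edgeSet, w ∈ (e : Sym2 W) ∧ g e = b := by
    intro w b
    -- In a finite graph, equal degrees in `F` and `T` force equal neighborhoods.
    have hN : F.neighborSet (f w) = T.neighborSet (f w) :=
      Set.eq_of_subset_of_ncard_le (F.neighborSet_subset _) (hdeg _ ⟨w, rfl⟩).le
    have hFb : T.Adj (f w) b ↔ F.Adj (f w) b := (Set.ext_iff.1 hN b).symm
    rw [hFb]
    constructor
    · intro hb
      obtain ⟨z, hz⟩ := φ.surjective ⟨b, F.edge_vert hb.symm⟩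
      have h1 : F.coe.Adj (φ (Sum.inl w)) (φ z) := by rw [hz]; exact hb
      rw [φ.map_adj_iff] at h1
      rcases z with w' | e
      · exact h1.elim
      · exact ⟨e, h1, congrArg Subtype.val hz⟩
    · rintro ⟨e, hwe, rfl⟩
      exact φ.map_adj_iff.2 (show (subdivision H).Adj (Sum.inl w) (Sum.inr e) from hwe)
  rw [hrange]
  refine ⟨stallerWins_of_realization hH hf hfg hg hadj (by simp), ?_⟩
  intro v hv
  obtain ⟨w₀, rfl⟩ : v ∈ Set.range f := by simpa using hv
  refine (dominatorWins_or_minimal_hallViolator hT _).resolve_right ?_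
  rintro ⟨X, hX⟩
  refine not_minimal_hallViolator_of_realization hH.connected hg hadj ?_ (w₀ := w₀) ?_ X hX
  · intro y hy
    by_contra h
    exact hy (Or.inl ⟨trivial, h⟩)
  · exact fun h => h (Or.inr rfl)

theorem IsCritical.exists_isSubstructure [Finite V] {T : SimpleGraph V} (hT : T.IsTree)
    (h : IsCritical T D) : ∃ (F : T.Subgraph) (X : Set F.verts), IsSubstructure T F X ∧
      D = Set.univ \ (Subtype.val '' X) := by
  have := Fintype.ofFinite V
  obtain ⟨X, hX⟩ := (dominatorWins_or_minimal_hallViolator hT D).resolve_left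
    h.1.not_dominatorWins
  obtain ⟨F, Z, hF, hZ⟩ := HallViolator.exists_isSubstructure hT hX
  refine ⟨F, Z, hF, ?_⟩
  have hsub : Subtype.val '' Z ⊆ Dᶜ := hZ ▸ hX.prop.1
  refine Set.Subset.antisymm (fun d hd => ⟨trivial, fun hdZ => hsub hdZ hd⟩) fun v hv => ?_
  by_contra hvD
  -- A vertex `v` outside both `D` and the substructure's `X` could be predominated without spoiling
  -- Staller's win on the substructure, against criticality.
  refine StallerWins.not_dominatorWins ?_ (h.2 v hvD)
  obtain ⟨hS, -⟩ := hF.isCritical hT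
  exact MBD.CanForce.mono_predominated hS (fun u hu => hu.elim (fun hu => ⟨trivial, fun hZ => hsub hZ hu⟩)
    fun hu => hu ▸ hv)

end MBD

theorem mainTheorem2 {V : Type*} [Finite V] (T : SimpleGraph V) (hT : T.IsTree) (D : Set V) :
    (MBD.IsCritical T D ↔
      ∃ (F : T.Subgraph) (X : Set F.verts), MBD.IsSubstructure T F X ∧
        D = Set.univ \ (Subtype.val '' X)) ∧
    (MBD.IsAtomicCritical T D ↔
      ∃ X : Set V, MBD.MemS T X ∧ D = Set.univ \ X) := by
  have hcrit : MBD.IsCritical T D ↔ ∃ (F : T.Subgraph) (X : Set F.verts),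
      MBD.IsSubstructure T F X ∧ D = Set.univ \ (Subtype.val '' X) := by
    refine ⟨fun h => h.exists_isSubstructure hT, ?_⟩
    rintro ⟨F, X, hF, rfl⟩
    exact hF.isCritical hT
  refine ⟨hcrit, ?_, ?_⟩
  · rintro ⟨hc, hind, hiso⟩
    obtain ⟨F, _, ⟨⟨W, hW, H, hH, φ, rfl⟩, hdeg⟩, hD⟩ := hcrit.1 hc
    set X : Set V := Subtype.val '' (Set.range fun w : W => φ (Sum.inl w)) with hXdef
    have hmem : ∀ v, v ∉ D → v ∈ X := fun v hv => by_contra fun h => hv (hD ▸ ⟨trivial, h⟩)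
    have hXF : ∀ v ∈ X, v ∈ F.verts := by
      rintro _ ⟨x, -, rfl⟩
      exact x.2
    have hXadj : ∀ v ∈ X, ∀ b, T.Adj v b → F.Adj v b := by
      rintro _ ⟨x, hx, rfl⟩ b hb
      have hN : F.neighborSet (x : V) = T.neighborSet (x : V) :=
        Set.eq_of_subset_of_ncard_le (F.neighborSet_subset _) (hdeg _ hx).le
      exact (Set.ext_iff.1 hN b).2 hb
    -- As `D` is independent, every edge of `T` has an end in `X`, where `F` has full degree.
    have hadj : ∀ a b, T.Adj a b → F.Adj a b := by
      intro a b hab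
      by_cases ha : a ∈ D
      · by_cases hb : b ∈ D
        · exact absurd hab (hind ha hb hab.ne)
        · exact (hXadj b (hmem b hb) a hab.symm).symm
      · exact hXadj a (hmem a ha) b hab
    have hverts : ∀ v, v ∈ F.verts := by
      intro v
      by_cases hv : v ∈ D
      · have h1 := hiso v hv
        simp only [SimpleGraph.IsIsolated, not_forall, not_not] at h1
        obtain ⟨b, hb⟩ := h1
        exact F.edge_vert (hadj _ _ hb)
      · exact hXF v (hmem v hv)
    let ψ : F.coe ≃g T :=
      { toEquiv := Equiv.subtypeUnivEquiv hverts
        map_rel_iff' := fun {a b} => ⟨fun h => hadj _ _ h, fun h => F.adj_sub h⟩ }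
    refine ⟨X, ⟨W, hW, H, hH, φ.trans ψ, ?_⟩, hD⟩
    rw [hXdef, ← Set.range_comp]
    rfl
  · rintro ⟨X, ⟨W, hW, H, hH, φ, rfl⟩, rfl⟩
    have hcompl : ∀ v ∈ Set.univ \ Set.range (fun w : W => φ (Sum.inl w)),
        ∃ e, v = φ (Sum.inr e) := by
      rintro v ⟨-, hv⟩
      obtain ⟨w | e, rfl⟩ := φ.surjective v
      · exact absurd ⟨w, rfl⟩ hv
      · exact ⟨e, rfl⟩
    refine ⟨hcrit.2 ⟨⊤, Set.range fun w : W => (φ.trans SimpleGraph.Subgraph.topIso.symm)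
      (Sum.inl w), ⟨⟨W, hW, H, hH, _, rfl⟩, ?_⟩, ?_⟩, ?_, ?_⟩
    · intro v _
      rw [SimpleGraph.Subgraph.neighborSet_top]
    · rw [← Set.range_comp]
      rfl
    · intro a ha b hb _ hab
      obtain ⟨e, rfl⟩ := hcompl a ha
      obtain ⟨e', rfl⟩ := hcompl b hb
      exact φ.map_adj_iff.1 hab
    · intro v hv hiso
      obtain ⟨⟨e, he⟩, rfl⟩ := hcompl v hv
      induction e using Sym2.ind with
      | _ x y =>
        exact hiso (φ (Sum.inl x)) (φ.map_adj_iff.2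
          (show (MBD.subdivision H).Adj (Sum.inr _) (Sum.inl x) from Sym2.mem_mk_left x y))
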